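/- **Proposition (centrality of $w_0$ via $y_J$).** Let $(W,S)$ be a finite Coxeter group with length function $\ell$, and let $w_0$ be the longest element of $W$. For $I\subseteq S$ let $$x_I=\sum_{\substack{w\in W\\ \ell(ws)>\ell(w)\ \forall s\in I}} w\in\mathbb{Q}W ,$$ and let $\Sigma(W)=\sum_{I\subseteq S}\mathbb{Q}\,x_I\subseteq\mathbb{Q}W$ be Solomon's descent algebra, a unital subalgebra of the group algebra $\mathbb{Q}W$. For $w\in W$ let $\mathcal{R}(w)=\{s\in S : \ell(ws)>\ell(w)\}$ be its right ascent set, and for $J\subseteq S$ let $$y_J=\sum_{\substack{w\in W\\ \mathcal{R}(w)=J}} w ,$$ which is an element of $\Sigma(W)$. Then $w_0$ is central in $W$ if and only if $y_J$ is invertible in $\Sigma(W)$ for every subset $J\subseteq S$. -/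

import Mathlib

namespace DescentAlgebra

variable {B W : Type*} [Group W] {M : CoxeterMatrix B}

/-- The set `S ⊆ W` of simple reflections of the Coxeter system. -/
def simpleSet (cs : CoxeterSystem M W) : Set W := Set.range cs.simple

/-- `w` is a longest element of `W`: its length is maximal. In a finite Coxeter group there is
exactly one such element. -/
def IsLongest (cs : CoxeterSystem M W) (w : W) : Prop := ∀ v : W, cs.length v ≤ cs.length w

/-- The right ascent set `R(w) = {s ∈ S | w s > w}`. For a simple reflection `s`, the relation
`w s > w` (in the Bruhat order) means `ℓ(w s) > ℓ(w)`. -/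
def ascentSet (cs : CoxeterSystem M W) (w : W) : Set W :=
  {s | s ∈ simpleSet cs ∧ cs.length w < cs.length (w * s)}

/-- `X_I`, the set of all `w` with `w s > w` for every `s ∈ I`. -/
def setX (cs : CoxeterSystem M W) (I : Set W) : Set W :=
  {w | ∀ s ∈ I, cs.length w < cs.length (w * s)}

/-- `Y_J`, the set of all `w` whose right ascent set is exactly `J`. -/
def setY (cs : CoxeterSystem M W) (J : Set W) : Set W :=
  {w | ascentSet cs w = J}

open Classical in
/-- The sum in `ℚW` of the elements of a subset of the finite group `W`. -/
noncomputable def setSum [Fintype W] (X : Set W) : MonoidAlgebra ℚ W :=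
  ∑ w : W with w ∈ X, MonoidAlgebra.of ℚ W w

/-- `x_I`, the sum in `ℚW` of the elements of `X_I`. -/
noncomputable def elemX [Fintype W] (cs : CoxeterSystem M W) (I : Set W) : MonoidAlgebra ℚ W :=
  setSum (setX cs I)

/-- `y_J`, the sum in `ℚW` of the elements of `Y_J`. -/
noncomputable def elemY [Fintype W] (cs : CoxeterSystem M W) (J : Set W) : MonoidAlgebra ℚ W :=
  setSum (setY cs J)

/-- Solomon's descent algebra `Σ(W)`, as a subspace of `ℚW`: the span of all `x_I` with `I ⊆ S`. -/
noncomputable def descentAlgebra [Fintype W] (cs : CoxeterSystem M W) :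
    Submodule ℚ (MonoidAlgebra ℚ W) :=
  Submodule.span ℚ {x | ∃ I : Set W, I ⊆ simpleSet cs ∧ x = elemX cs I}

/-- `a` is an invertible element of `Σ(W)`: it lies in `Σ(W)` and has a two-sided inverse
that lies in `Σ(W)`. -/
def IsInvertible [Fintype W] (cs : CoxeterSystem M W) (a : MonoidAlgebra ℚ W) : Prop :=
  a ∈ descentAlgebra cs ∧ ∃ b ∈ descentAlgebra cs, a * b = 1 ∧ b * a = 1

end DescentAlgebra

/-! Solomon's formula writes x_J x_K as a sum of x_L with L = K ∩ d⁻¹ W_J d ⊆ K. Left multiplication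
by x_J is therefore triangular for inclusion, and its diagonal entry at K, `diagCoeff`, is the
number of cosets g W_J fixed by K. Inclusion-exclusion gives y_J = ∑ (-1)^|T| x_{J ∪ T} over T ⊆ S \
J, so y_J acts triangularly too.

If w₀ is central, g W_J ↦ g w₀ W_J is a fixed-point-free involution on these cosets for J ≠ S. Every
`diagCoeff` with J ≠ S is thus even, while x_S = 1 contributes ±1. The diagonal entries of y_J are
odd, hence nonzero.

If w₀ is not central, it moves some r ∈ S under conjugation. For J = S \ {r}, y_J = x_J - 1, and the
diagonal entry of x_J at J is 1. So y_J sends the span of the x_L, L ⊆ J, into the span of those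
with L ≠ J, which is smaller.

The Coxeter combinatorics rests on the cocycle `invParity`, which detects the inversions of w
without a root system. -/

namespace DescentAlgebra

/-! ### The inversion cocycle and the exchange condition -/

section InversionParity

variable {B W : Type*} [Group W] {M : CoxeterMatrix B}

open Classical in
/-- The permutation `(t, ε) ↦ (s t s, ε + [t = s])` of `W × ℤ/2` attached to a simple
reflection `s`. -/
noncomputable def simplePerm (cs : CoxeterSystem M W) (i : B) : Equiv.Perm (W × ZMod 2) :=
  Function.Involutive.toPerm
    (fun p => (cs.simple i * p.1 * cs.simple i, p.2 + if p.1 = cs.simple i then 1 else 0)) (by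
      rintro ⟨t, e⟩
      have h : cs.simple i * t * cs.simple i = cs.simple i ↔ t = cs.simple i := by
        constructor
        · intro h
          have := congrArg (fun x => cs.simple i * x * cs.simple i) h
          simpa [mul_assoc] using this
        · rintro rfl; simp
      ext
      · simp [mul_assoc]
      · simp only [h, add_assoc, CharTwo.add_self_eq_zero, add_zero])

open Classical in
theorem simplePerm_apply (cs : CoxeterSystem M W) (i : B) (t : W) (e : ZMod 2) :
    simplePerm cs i (t, e) =
      (cs.simple i * t * cs.simple i, e + if t = cs.simple i then 1 else 0) := rfl

-- The second coordinate counts how often t occurs in the inversion sequence of the alternating word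
-- of length 2k.
open Classical in
theorem simplePerm_mul_pow_apply (cs : CoxeterSystem M W) (i j : B) (t : W) (e : ZMod 2) (k : ℕ) :
    ((simplePerm cs i * simplePerm cs j) ^ k) (t, e) =
      ((cs.simple i * cs.simple j) ^ k * t * ((cs.simple i * cs.simple j) ^ k)⁻¹,
        e + ∑ q ∈ Finset.range (2 * k),
          if t = ((cs.simple i * cs.simple j) ^ q)⁻¹ * cs.simple j then 1 else 0) := by
  set p := cs.simple i * cs.simple j with hp
  have hc : ∀ l : ℕ, cs.simple j * p ^ l = (p ^ l)⁻¹ * cs.simple j := by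
    intro l
    have h1 : cs.simple j * p * (cs.simple j)⁻¹ = p⁻¹ := by simp [hp, mul_assoc]
    have h2 : cs.simple j * p ^ l * (cs.simple j)⁻¹ = (p ^ l)⁻¹ := by
      rw [← conj_pow, h1, inv_pow]
    rw [← h2]; simp
  induction k with
  | zero => simp
  | succ k ih =>
    have e1 : p ^ k * t * (p ^ k)⁻¹ = cs.simple j ↔ t = (p ^ (2 * k))⁻¹ * cs.simple j := by
      rw [two_mul, pow_add, mul_inv_rev, mul_assoc (p ^ k)⁻¹, ← hc]
      constructor
      · intro h; rw [← h]; group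
      · intro h; rw [h]; group
    have e2 : cs.simple j * (p ^ k * t * (p ^ k)⁻¹) * cs.simple j = cs.simple i ↔
        t = (p ^ (2 * k + 1))⁻¹ * cs.simple j := by
      have : (p ^ (2 * k + 1))⁻¹ * cs.simple j =
          (p ^ k)⁻¹ * (cs.simple j * cs.simple i * cs.simple j) * p ^ k := by
        have : cs.simple j * cs.simple i = p⁻¹ := by simp [hp]
        rw [this, mul_assoc, mul_assoc, hc]
        group
      rw [this]
      constructor
      · intro h; rw [← h]; simp [mul_assoc]
      · intro h; rw [h]; simp [mul_assoc]
    rw [pow_succ', Equiv.Perm.mul_apply, ih, Equiv.Perm.mul_apply, simplePerm_apply,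
      simplePerm_apply, mul_add, mul_one, Finset.sum_range_succ, Finset.sum_range_succ]
    simp only [e1, e2]
    refine Prod.ext ?_ ?_
    · simp only [pow_succ' p k, mul_inv_rev]
      simp [hp, mul_assoc]
    · simp only [add_assoc]

theorem simplePerm_isLiftable (cs : CoxeterSystem M W) : M.IsLiftable (simplePerm cs) := by
  classical
  intro i j
  ext1 ⟨t, e⟩
  -- At k = M i j the sequence of reflections runs twice through one period, so the two halves
  -- cancel mod 2.
  rw [simplePerm_mul_pow_apply, two_mul, Finset.sum_range_add]
  simp only [pow_add, cs.simple_mul_simple_pow, one_mul, CharTwo.add_self_eq_zero]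
  simp

/-- The action of `W` on `W × ℤ/2` extending `simplePerm`. -/
noncomputable def parityRep (cs : CoxeterSystem M W) : W →* Equiv.Perm (W × ZMod 2) :=
  cs.lift ⟨simplePerm cs, simplePerm_isLiftable cs⟩

/-- The parity of the number of times that `t` occurs in the inversion sequence of a word
for `w`. -/
noncomputable def invParity (cs : CoxeterSystem M W) (w t : W) : ZMod 2 :=
  (parityRep cs w (t, 0)).2

theorem parityRep_simple (cs : CoxeterSystem M W) (i : B) :
    parityRep cs (cs.simple i) = simplePerm cs i := by
  simp [parityRep]

theorem parityRep_apply (cs : CoxeterSystem M W) (w t : W) (e : ZMod 2) :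
    parityRep cs w (t, e) = (w * t * w⁻¹, e + invParity cs w t) := by
  unfold invParity
  revert t e
  induction w using cs.simple_induction_left with
  | one => simp
  | mul_simple_left w i ih =>
    intro t e
    rw [map_mul, Equiv.Perm.mul_apply, Equiv.Perm.mul_apply, ih t e, ih t 0, parityRep_simple,
      simplePerm_apply, simplePerm_apply]
    refine Prod.ext ?_ ?_
    · simp [mul_assoc]
    · simp only [zero_add, add_assoc]

variable (cs : CoxeterSystem M W)

/-- Cocycle identity: the inversion sequence of a concatenated word is that of v, followed by that
of u conjugated back by v. -/
theorem invParity_mul (u v t : W) :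
    invParity cs (u * v) t = invParity cs v t + invParity cs u (v * t * v⁻¹) := by
  conv_lhs => rw [invParity, map_mul, Equiv.Perm.mul_apply, parityRep_apply, parityRep_apply]
  simp

open Classical in
theorem invParity_simple (i : B) (t : W) :
    invParity cs (cs.simple i) t = if t = cs.simple i then 1 else 0 := by
  rw [invParity, parityRep_simple, simplePerm_apply]; simp

@[simp] theorem invParity_one (t : W) : invParity cs 1 t = 0 := by simp [invParity]

theorem invParity_eq_zero_or_one (w t : W) : invParity cs w t = 0 ∨ invParity cs w t = 1 := by
  generalize invParity cs w t = x
  revert x; decide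

theorem invParity_ne_one {w t : W} : invParity cs w t ≠ 1 ↔ invParity cs w t = 0 := by
  generalize invParity cs w t = x
  revert x; decide

theorem invParity_ne_zero {w t : W} : invParity cs w t ≠ 0 ↔ invParity cs w t = 1 := by
  generalize invParity cs w t = x
  revert x; decide

theorem invParity_inv_conj (d t : W) :
    invParity cs d t = invParity cs d⁻¹ (d * t * d⁻¹) := by
  have h := invParity_mul cs d⁻¹ d t
  rw [inv_mul_cancel, invParity_one] at h
  rw [← CharTwo.add_eq_zero, ← h]

/-- The exchange condition. -/
theorem exists_word_of_invParity_eq_one (ω : List B) (t : W)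
    (h : invParity cs (cs.wordProd ω) t = 1) :
    ∃ ω' : List B, ω'.Sublist ω ∧ ω'.length + 1 = ω.length ∧
      cs.wordProd ω' = cs.wordProd ω * t := by
  classical
  induction ω with
  | nil => simp at h
  | cons i ω ih =>
    rw [cs.wordProd_cons, invParity_mul, invParity_simple] at h
    -- If t is not an inversion of the tail, it comes from the first letter, which is deleted;
    -- otherwise a letter of the tail is.
    rcases invParity_eq_zero_or_one cs (cs.wordProd ω) t with h0 | h1
    · rw [h0, zero_add] at h
      have h2 : cs.wordProd ω * t * (cs.wordProd ω)⁻¹ = cs.simple i := by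
        by_contra hne; simp [hne] at h
      refine ⟨ω, List.sublist_cons_self _ _, by simp, ?_⟩
      rw [cs.wordProd_cons, mul_assoc, mul_inv_eq_iff_eq_mul.1 h2,
        cs.simple_mul_simple_cancel_left]
    · obtain ⟨ω', hs, hl, hp⟩ := ih h1
      exact ⟨i :: ω', hs.cons_cons i, by simp [hl], by
        rw [cs.wordProd_cons, cs.wordProd_cons, hp, mul_assoc]⟩

theorem length_mul_lt_of_invParity_eq_one {w t : W} (h : invParity cs w t = 1) :
    cs.length (w * t) < cs.length w := by
  obtain ⟨ω, hω, rfl⟩ := cs.exists_isReduced w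
  obtain ⟨ω', -, hl, hp⟩ := exists_word_of_invParity_eq_one cs ω t h
  rw [← hp, hω.eq, ← hl]
  exact Nat.lt_succ_of_le (cs.length_wordProd_le ω')

/-- The contributions of w and w⁻¹ cancel, leaving that of the simple reflection at itself. -/
theorem invParity_conj_self (w : W) (i : B) :
    invParity cs (w * cs.simple i * w⁻¹) (w * cs.simple i * w⁻¹) = 1 := by
  have h1 := invParity_inv_conj cs w (cs.simple i)
  rw [invParity_mul, invParity_mul, ← h1, invParity_simple]
  simp only [inv_inv, mul_assoc, inv_mul_cancel_left, inv_mul_cancel, mul_one]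
  simp only [if_true, cs.simple_mul_simple_self, cs.inv_simple, mul_one]
  rw [add_left_comm, CharTwo.add_self_eq_zero, add_zero]

theorem length_lt_mul_of_invParity_eq_zero {w t : W} (ht : invParity cs t t = 1)
    (h : invParity cs w t = 0) (htt : t * t = 1) : cs.length w < cs.length (w * t) := by
  have h1 : invParity cs (w * t) t = 1 := by
    rw [invParity_mul, ht, mul_inv_cancel_right, h, add_zero]
  have := length_mul_lt_of_invParity_eq_one cs h1
  rwa [mul_assoc, htt, mul_one] at this

theorem invParity_simple_self {s : W} (hs : s ∈ simpleSet cs) : invParity cs s s = 1 := by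
  obtain ⟨i, rfl⟩ := hs
  simp [invParity_simple]

theorem eq_of_invParity_simple {s t : W} (hs : s ∈ simpleSet cs) (h : invParity cs s t = 1) :
    t = s := by
  obtain ⟨i, rfl⟩ := hs
  rw [invParity_simple] at h
  by_contra hne
  simp [hne] at h

theorem mul_self_of_mem_simpleSet {s : W} (hs : s ∈ simpleSet cs) : s * s = 1 := by
  obtain ⟨i, rfl⟩ := hs
  simp

theorem length_lt_mul_simple_iff {w s : W} (hs : s ∈ simpleSet cs) :
    cs.length w < cs.length (w * s) ↔ invParity cs w s = 0 := by
  constructor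
  · intro h
    rw [← invParity_ne_one]
    intro h1
    exact absurd (length_mul_lt_of_invParity_eq_one cs h1) (by omega)
  · intro h
    exact length_lt_mul_of_invParity_eq_zero cs (invParity_simple_self cs hs) h
      (mul_self_of_mem_simpleSet cs hs)

theorem eq_one_of_forall_invParity_eq_zero {w : W}
    (h : ∀ s ∈ simpleSet cs, invParity cs w s = 0) : w = 1 := by
  by_contra hw
  obtain ⟨i, hi⟩ := cs.exists_rightDescent_of_ne_one hw
  have := (length_lt_mul_simple_iff cs (Set.mem_range_self i)).2 (h _ (Set.mem_range_self i))
  exact absurd hi (by unfold CoxeterSystem.IsRightDescent; omega)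

theorem mem_setX_iff {I : Set W} (hI : I ⊆ simpleSet cs) {w : W} :
    w ∈ setX cs I ↔ ∀ s ∈ I, invParity cs w s = 0 :=
  forall₂_congr fun _ hs => length_lt_mul_simple_iff cs (hI hs)

end InversionParity

/-! ### Parabolic subgroups and minimal coset representatives -/

section Parabolic

variable {B W : Type*} [Group W] {M : CoxeterMatrix B} (cs : CoxeterSystem M W) {J : Set W}

theorem exists_word_of_mem_closure (hJ : J ⊆ simpleSet cs) {u : W}
    (hu : u ∈ Subgroup.closure J) :
    ∃ ω : List B, (∀ i ∈ ω, cs.simple i ∈ J) ∧ cs.wordProd ω = u := by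
  induction hu using Subgroup.closure_induction with
  | mem x hx =>
    obtain ⟨i, rfl⟩ := hJ hx
    exact ⟨[i], by simpa using hx, by simp⟩
  | one => exact ⟨[], by simp, by simp⟩
  | mul x y _ _ hx hy =>
    obtain ⟨a, ha, rfl⟩ := hx
    obtain ⟨b, hb, rfl⟩ := hy
    refine ⟨a ++ b, ?_, cs.wordProd_append a b⟩
    intro i hi
    exact (List.mem_append.1 hi).elim (ha i) (hb i)
  | inv x _ hx =>
    obtain ⟨a, ha, rfl⟩ := hx
    exact ⟨a.reverse, by simpa using ha, cs.wordProd_reverse a⟩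

theorem mem_closure_of_invParity_eq_one (hJ : J ⊆ simpleSet cs) {u t : W}
    (hu : u ∈ Subgroup.closure J) (h : invParity cs u t = 1) : t ∈ Subgroup.closure J := by
  obtain ⟨ω, hω, rfl⟩ := exists_word_of_mem_closure cs hJ hu
  obtain ⟨ω', hs, -, hp⟩ := exists_word_of_invParity_eq_one cs ω t h
  have mem : ∀ l : List B, (∀ i ∈ l, cs.simple i ∈ J) →
      cs.wordProd l ∈ Subgroup.closure J := by
    intro l hl
    refine Subgroup.list_prod_mem _ fun x hx => ?_
    obtain ⟨i, hi, rfl⟩ := List.mem_map.1 hx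
    exact Subgroup.subset_closure (hl i hi)
  have := mul_mem (inv_mem (mem ω hω)) (mem ω' fun i hi => hω i (hs.subset hi))
  rwa [hp, inv_mul_cancel_left] at this

/-- Take a shortest word for u among words in J. If its last letter were not an inversion of u, it
would be one of the preceding prefix, and exchange would give a shorter word in J. -/
theorem eq_one_of_mem_closure (hJ : J ⊆ simpleSet cs) {u : W} (hu : u ∈ Subgroup.closure J)
    (h : ∀ j ∈ J, invParity cs u j = 0) : u = 1 := by
  classical
  have hex : ∃ n, ∃ ω : List B, ω.length = n ∧ (∀ i ∈ ω, cs.simple i ∈ J) ∧ cs.wordProd ω = u := by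
    obtain ⟨ω, hω, hp⟩ := exists_word_of_mem_closure cs hJ hu
    exact ⟨_, ω, rfl, hω, hp⟩
  obtain ⟨ω, hl, hω, hp⟩ := Nat.find_spec hex
  rcases List.eq_nil_or_concat ω with rfl | ⟨ω₁, i, rfl⟩
  · simpa using hp.symm
  · have hi : cs.simple i ∈ J := hω i (by simp)
    rw [cs.wordProd_concat] at hp
    have h1 : invParity cs (cs.wordProd ω₁) (cs.simple i) = 1 := by
      have := h _ hi
      rw [← hp, invParity_mul, invParity_simple_self cs (hJ hi), mul_inv_cancel_right] at this
      rw [← invParity_ne_zero]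
      intro h0
      simp [h0] at this
    obtain ⟨ω₂, hs, hl₂, hp₂⟩ := exists_word_of_invParity_eq_one cs ω₁ _ h1
    refine absurd ⟨ω₂, rfl, fun k hk => hω k ?_, hp₂.trans hp⟩
      (Nat.find_min hex (m := ω₂.length) ?_)
    · rw [← hl, List.length_concat]; omega
    · simp [hs.subset hk]

theorem mem_of_simple_mem_closure (hJ : J ⊆ simpleSet cs) {s : W} (hs : s ∈ simpleSet cs)
    (h : s ∈ Subgroup.closure J) : s ∈ J := by
  by_contra hsJ
  have h1 : s = 1 := eq_one_of_mem_closure cs hJ h fun j hj => by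
    rw [← invParity_ne_one]
    intro h1
    exact hsJ (eq_of_invParity_simple cs hs h1 ▸ hj)
  have := invParity_simple_self cs hs
  rw [h1, invParity_one] at this
  exact zero_ne_one this

theorem exists_minimal_mul (J : Set W) (w : W) : ∃ u ∈ Subgroup.closure J,
    ∀ t ∈ Subgroup.closure J, invParity cs (w * u) t = 0 := by
  obtain ⟨u, hu, hmin⟩ := WellFounded.has_min
    (InvImage.wf (fun u => cs.length (w * u)) wellFounded_lt)
    (Subgroup.closure J : Set W) ⟨1, one_mem _⟩
  refine ⟨u, hu, fun t ht => ?_⟩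
  rw [← invParity_ne_one]
  intro h
  refine hmin (u * t) (mul_mem hu ht) ?_
  have := length_mul_lt_of_invParity_eq_one cs h
  rwa [mul_assoc] at this

theorem eq_one_of_mul_mem_setX (hJ : J ⊆ simpleSet cs) {a u : W} (hu : u ∈ Subgroup.closure J)
    (ha : ∀ t ∈ Subgroup.closure J, invParity cs a t = 0) (h : a * u ∈ setX cs J) : u = 1 := by
  refine eq_one_of_mem_closure cs hJ hu fun j hj => ?_
  have h1 := (mem_setX_iff cs hJ).1 h j hj
  rwa [invParity_mul, ha _ (mul_mem (mul_mem hu (Subgroup.subset_closure hj)) (inv_mem hu)),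
    add_zero] at h1

/-- A shortest element of a W_J has no inversion in W_J, and it is the only element of that coset
lying in X_J, so it is a. -/
theorem invParity_eq_zero_of_mem_setX (hJ : J ⊆ simpleSet cs) {a t : W} (ha : a ∈ setX cs J)
    (ht : t ∈ Subgroup.closure J) : invParity cs a t = 0 := by
  obtain ⟨u, hu, hmin⟩ := exists_minimal_mul cs J a
  have h : u⁻¹ = 1 := eq_one_of_mul_mem_setX cs hJ (inv_mem hu) hmin (by simpa using ha)
  rw [inv_eq_one] at h
  simpa [h] using hmin t ht

theorem exists_mul_mem_setX (hJ : J ⊆ simpleSet cs) (w : W) :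
    ∃ u ∈ Subgroup.closure J, w * u ∈ setX cs J := by
  obtain ⟨u, hu, hmin⟩ := exists_minimal_mul cs J w
  exact ⟨u, hu, (mem_setX_iff cs hJ).2 fun j hj => hmin j (Subgroup.subset_closure hj)⟩

theorem eq_of_mem_setX (hJ : J ⊆ simpleSet cs) {a b : W} (ha : a ∈ setX cs J)
    (hb : b ∈ setX cs J) (h : a⁻¹ * b ∈ Subgroup.closure J) : a = b := by
  have := eq_one_of_mul_mem_setX cs hJ h
    (fun t ht => invParity_eq_zero_of_mem_setX cs hJ ha ht) (by simpa using hb)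
  rwa [inv_mul_eq_one] at this

end Parabolic

/-! ### Solomon's multiplication formula and its diagonal coefficients -/

section Solomon

variable {B W : Type*} [Group W] {M : CoxeterMatrix B} (cs : CoxeterSystem M W) {J K : Set W}

/-- The elements of `K` that `d` conjugates into the parabolic subgroup generated by `J`. -/
def conjInter (J K : Set W) (d : W) : Set W :=
  {k | k ∈ K ∧ d * k * d⁻¹ ∈ Subgroup.closure J}

theorem conjInter_subset (J K : Set W) (d : W) : conjInter J K d ⊆ K := fun _ h => h.1

theorem invParity_eq_zero_of_conj_mem (hJ : J ⊆ simpleSet cs) {d k : W} (hd : d⁻¹ ∈ setX cs J)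
    (hk : d * k * d⁻¹ ∈ Subgroup.closure J) : invParity cs d k = 0 := by
  rw [invParity_inv_conj]
  exact invParity_eq_zero_of_mem_setX cs hJ hd hk

/-- For k ∈ K the parity of u d at k is that of d at k plus that of u at d k d⁻¹. If d k d⁻¹ ∈ W_J,
the first term vanishes and left multiplication by a changes nothing; otherwise the second vanishes,
as all inversions of u lie in W_J. -/
theorem mul_mem_setX_iff (hJ : J ⊆ simpleSet cs) (hK : K ⊆ simpleSet cs) {a u d : W}
    (ha : a ∈ setX cs J) (hu : u ∈ Subgroup.closure J) (hd : d⁻¹ ∈ setX cs J) :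
    u * d ∈ setX cs K ↔ d ∈ setX cs K ∧ a * (u * d) ∈ setX cs (conjInter J K d) := by
  rw [mem_setX_iff cs hK, mem_setX_iff cs hK, mem_setX_iff cs ((conjInter_subset J K d).trans hK)]
  have key : ∀ k, d * k * d⁻¹ ∈ Subgroup.closure J →
      invParity cs (a * (u * d)) k = invParity cs (u * d) k := by
    intro k hk
    rw [invParity_mul cs a, invParity_eq_zero_of_mem_setX cs hJ ha, add_zero]
    have := mul_mem (mul_mem hu hk) (inv_mem hu)
    simpa [mul_assoc] using this
  constructor
  · intro h
    refine ⟨fun k hk => ?_, fun k hk => (key k hk.2).trans (h k hk.1)⟩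
    by_cases hc : d * k * d⁻¹ ∈ Subgroup.closure J
    · exact invParity_eq_zero_of_conj_mem cs hJ hd hc
    · have h1 := h k hk
      have h2 : invParity cs u (d * k * d⁻¹) = 0 := by
        rw [← invParity_ne_one]
        exact fun h => hc (mem_closure_of_invParity_eq_one cs hJ hu h)
      rwa [invParity_mul, h2, add_zero] at h1
  · rintro ⟨h1, h2⟩ k hk
    by_cases hc : d * k * d⁻¹ ∈ Subgroup.closure J
    · rw [← key k hc]
      exact h2 k ⟨hk, hc⟩
    · rw [invParity_mul, h1 k hk, zero_add, ← invParity_ne_one]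
      exact fun h => hc (mem_closure_of_invParity_eq_one cs hJ hu h)

theorem setX_simpleSet : setX cs (simpleSet cs) = {1} := by
  ext w
  rw [mem_setX_iff cs subset_rfl, Set.mem_singleton_iff]
  exact ⟨eq_one_of_forall_invParity_eq_zero cs, by rintro rfl; simp⟩

theorem closure_simpleSet : Subgroup.closure (simpleSet cs) = ⊤ :=
  cs.subgroup_closure_range_simple

variable [Fintype W]

open Classical in
/-- Solomon's multiplication formula. -/
theorem elemX_mul_elemX (hJ : J ⊆ simpleSet cs) (hK : K ⊆ simpleSet cs) :
    elemX cs J * elemX cs K =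
      ∑ d : W with d⁻¹ ∈ setX cs J ∧ d ∈ setX cs K, elemX cs (conjInter J K d) := by
  choose r hr hr' using exists_mul_mem_setX cs hJ
  unfold elemX setSum
  rw [Finset.sum_mul_sum, Finset.sum_sigma', Finset.sum_sigma']
  -- The pair (a, b) goes to (d, a b), where d represents the coset W_J b and d⁻¹ ∈ X_J.
  refine Finset.sum_bij (fun p _ => ⟨(p.2⁻¹ * r p.2⁻¹)⁻¹, p.1 * p.2⟩) ?_ ?_ ?_ ?_
  · rintro ⟨a, b⟩ hp
    simp only [Finset.mem_sigma, Finset.mem_filter, Finset.mem_univ, true_and] at hp ⊢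
    have := (mul_mem_setX_iff cs hJ hK hp.1 (hr b⁻¹) (d := (b⁻¹ * r b⁻¹)⁻¹)
      (by simpa using hr' b⁻¹)).1 (by simpa using hp.2)
    refine ⟨⟨by simpa using hr' b⁻¹, this.1⟩, by simpa using this.2⟩
  · rintro ⟨a, b⟩ hp ⟨a', b'⟩ hp' h
    simp only [Finset.mem_sigma, Finset.mem_filter, Finset.mem_univ, true_and] at hp hp'
    simp only [Sigma.mk.injEq, heq_eq_eq, inv_inj] at h
    obtain ⟨h1, h2⟩ := h
    have h3 : a⁻¹ * a' = r b⁻¹ * (r b'⁻¹)⁻¹ := by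
      have e1 : a' = a * b * b'⁻¹ := by rw [h2]; simp
      have e2 : b'⁻¹ = b⁻¹ * r b⁻¹ * (r b'⁻¹)⁻¹ := by rw [h1]; simp
      rw [e1]
      nth_rewrite 1 [e2]
      group
    have h4 : a = a' := eq_of_mem_setX cs hJ hp.1 hp'.1
      (h3 ▸ mul_mem (hr _) (inv_mem (hr _)))
    subst h4
    simpa using h2
  · rintro ⟨d, w⟩ hp
    simp only [Finset.mem_sigma, Finset.mem_filter, Finset.mem_univ, true_and] at hp
    obtain ⟨⟨hd, hdK⟩, hw⟩ := hp
    -- The preimage comes from moving u ∈ W_J across w = (w d⁻¹) d so that the left factor lands in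
    -- X_J.
    obtain ⟨u, hu, ha⟩ := exists_mul_mem_setX cs hJ (w * d⁻¹)
    have hb : u⁻¹ * d ∈ setX cs K :=
      (mul_mem_setX_iff cs hJ hK ha (inv_mem hu) hd).2 ⟨hdK, by simpa [mul_assoc] using hw⟩
    refine ⟨⟨w * d⁻¹ * u, u⁻¹ * d⟩, by simp [ha, hb], ?_⟩
    have h1 : (u⁻¹ * d)⁻¹ * r (u⁻¹ * d)⁻¹ = d⁻¹ :=
      eq_of_mem_setX cs hJ (hr' _) hd (by
        have := mul_mem (inv_mem (hr (u⁻¹ * d)⁻¹)) (inv_mem hu)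
        simpa [mul_assoc] using this)
    simp only [h1]
    simp
  · rintro ⟨a, b⟩ _
    simp

/-- The span of the `x_L` with `L` strictly contained in `K`. -/
noncomputable def spanBelow (cs : CoxeterSystem M W) (K : Set W) :
    Submodule ℚ (MonoidAlgebra ℚ W) :=
  Submodule.span ℚ {x | ∃ L : Set W, L ⊂ K ∧ x = elemX cs L}

open Classical in
/-- The number of cosets of the parabolic subgroup generated by `J` that are fixed by `K`. -/
noncomputable def diagCoeff (cs : CoxeterSystem M W) (J K : Set W) : ℕ :=
  (Finset.univ.filter fun d : W =>
    d⁻¹ ∈ setX cs J ∧ ∀ k ∈ K, d * k * d⁻¹ ∈ Subgroup.closure J).card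

theorem elemX_mul_elemX_sub_mem (hJ : J ⊆ simpleSet cs) (hK : K ⊆ simpleSet cs) :
    elemX cs J * elemX cs K - (diagCoeff cs J K : ℚ) • elemX cs K ∈ spanBelow cs K := by
  classical
  rw [elemX_mul_elemX cs hJ hK, ← Finset.sum_filter_add_sum_filter_not _
    (fun d => ∀ k ∈ K, d * k * d⁻¹ ∈ Subgroup.closure J), Finset.filter_filter]
  -- When d conjugates K into W_J, the condition d ∈ X_K is automatic.
  have h1 : (Finset.univ.filter fun d : W => (d⁻¹ ∈ setX cs J ∧ d ∈ setX cs K) ∧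
      ∀ k ∈ K, d * k * d⁻¹ ∈ Subgroup.closure J) = Finset.univ.filter fun d : W =>
        d⁻¹ ∈ setX cs J ∧ ∀ k ∈ K, d * k * d⁻¹ ∈ Subgroup.closure J := by
    refine Finset.filter_congr fun d _ => ⟨fun h => ⟨h.1.1, h.2⟩, fun h => ⟨⟨h.1, ?_⟩, h.2⟩⟩
    exact (mem_setX_iff cs hK).2 fun k hk => invParity_eq_zero_of_conj_mem cs hJ h.1 (h.2 k hk)
  have h2 : ∀ d ∈ (Finset.univ.filter fun d : W =>
      d⁻¹ ∈ setX cs J ∧ ∀ k ∈ K, d * k * d⁻¹ ∈ Subgroup.closure J),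
      elemX cs (conjInter J K d) = elemX cs K := by
    intro d hd
    congr 1
    exact (conjInter_subset J K d).antisymm fun k hk => ⟨hk, (Finset.mem_filter.1 hd).2.2 k hk⟩
  rw [h1, Finset.sum_congr rfl h2, Finset.sum_const, ← Nat.cast_smul_eq_nsmul ℚ, diagCoeff,
    add_sub_cancel_left]
  refine Submodule.sum_mem _ fun d hd => Submodule.subset_span ⟨_, ?_, rfl⟩
  refine (conjInter_subset J K d).ssubset_of_ne fun h => (Finset.mem_filter.1 hd).2 fun k hk => ?_
  rw [← h] at hk
  exact hk.2

theorem elemX_simpleSet : elemX cs (simpleSet cs) = 1 := by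
  classical
  simp [elemX, setSum, setX_simpleSet, MonoidAlgebra.one_def, Finset.sum_filter]

theorem diagCoeff_simpleSet (K : Set W) : diagCoeff cs (simpleSet cs) K = 1 := by
  classical
  rw [diagCoeff, Finset.card_eq_one]
  exact ⟨1, by ext d; simp [setX_simpleSet, closure_simpleSet]⟩

open Classical in
theorem setSum_coeff (X : Set W) (w : W) :
    (setSum X).coeff w = if w ∈ X then 1 else 0 := by
  simp [setSum, MonoidAlgebra.coeff_sum, Finsupp.single_apply]

end Solomon

/-! ### The longest element and the parity of fixed cosets -/

section Longest

variable {B W : Type*} [Group W] {M : CoxeterMatrix B} (cs : CoxeterSystem M W) {w₀ : W}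

theorem IsLongest.invParity_conj (hw₀ : IsLongest cs w₀) {s : W} (hs : s ∈ simpleSet cs) (u : W) :
    invParity cs w₀ (u * s * u⁻¹) = 1 := by
  have htt : u * s * u⁻¹ * (u * s * u⁻¹) = 1 := by
    have := mul_self_of_mem_simpleSet cs hs
    simp only [mul_assoc, inv_mul_cancel_left, ← mul_assoc s s, this, one_mul, mul_inv_cancel]
  obtain ⟨i, rfl⟩ := hs
  rw [← invParity_ne_zero]
  intro h
  exact absurd (length_lt_mul_of_invParity_eq_zero cs (invParity_conj_self cs u i) h htt)
    (not_lt.2 (hw₀ _))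

theorem IsLongest.invParity_simple (hw₀ : IsLongest cs w₀) {s : W} (hs : s ∈ simpleSet cs) :
    invParity cs w₀ s = 1 := by
  simpa using hw₀.invParity_conj cs hs 1

theorem IsLongest.eq_of_forall_invParity_eq_one (hw₀ : IsLongest cs w₀) {x : W}
    (hx : ∀ s ∈ simpleSet cs, invParity cs x s = 1) : x = w₀ := by
  have h : w₀⁻¹ * x = 1 := eq_one_of_forall_invParity_eq_zero cs fun s hs => by
    have h1 := hx s hs
    rw [← mul_inv_cancel_left w₀ x, invParity_mul, hw₀.invParity_conj cs hs] at h1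
    simpa using h1
  rw [inv_mul_eq_one] at h
  exact h.symm

/-- In the parity of w₀ s w₀⁻¹ at a simple t, the outer factors contribute 1 + 1 = 0 and s
contributes only if w₀⁻¹ t w₀ = s. A non-simple conjugate would thus have no simple inversion and be
trivial. -/
theorem IsLongest.conj_mem_simpleSet (hw₀ : IsLongest cs w₀) {s : W} (hs : s ∈ simpleSet cs) :
    w₀ * s * w₀⁻¹ ∈ simpleSet cs := by
  by_contra hv
  have hs1 : w₀ * s * w₀⁻¹ = 1 := eq_one_of_forall_invParity_eq_zero cs fun t ht => by
    rw [← invParity_ne_one]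
    intro h1
    have e1 : invParity cs w₀⁻¹ t = 1 := by
      have := invParity_inv_conj cs w₀⁻¹ t
      rw [this, inv_inv]
      simpa using hw₀.invParity_conj cs ht w₀⁻¹
    have e2 : invParity cs w₀ (s * (w₀⁻¹ * t * w₀⁻¹⁻¹) * s⁻¹) = 1 := by
      have := hw₀.invParity_conj cs ht (s * w₀⁻¹)
      simpa [mul_assoc] using this
    rw [invParity_mul, e1, invParity_mul, e2] at h1
    have e3 : invParity cs s (w₀⁻¹ * t * w₀⁻¹⁻¹) = 1 := by
      rwa [add_comm _ (1 : ZMod 2), ← add_assoc, CharTwo.add_self_eq_zero, zero_add] at h1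
    have e4 := eq_of_invParity_simple cs hs e3
    refine hv ?_
    rw [← e4]
    simpa [mul_assoc] using ht
  have h := invParity_simple_self cs hs
  rw [conj_eq_one_iff] at hs1
  rw [hs1, invParity_one] at h
  exact zero_ne_one h

theorem IsLongest.mul_self (hw₀ : IsLongest cs w₀) : w₀ * w₀ = 1 := by
  refine eq_one_of_forall_invParity_eq_zero cs fun s hs => ?_
  rw [invParity_mul, hw₀.invParity_conj cs hs, hw₀.invParity_simple cs hs,
    CharTwo.add_self_eq_zero]

theorem IsLongest.not_mem_closure (hw₀ : IsLongest cs w₀) {J : Set W} (hJ : J ⊂ simpleSet cs) :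
    w₀ ∉ Subgroup.closure J := by
  intro h
  refine hJ.2 fun s hs => mem_of_simple_mem_closure cs hJ.1 hs ?_
  exact mem_closure_of_invParity_eq_one cs hJ.1 h (hw₀.invParity_simple cs hs)

theorem exists_simple_conj_ne (h : w₀ ∉ Subgroup.center W) :
    ∃ r ∈ simpleSet cs, w₀ * r * w₀⁻¹ ≠ r := by
  by_contra! hr
  refine h (Subgroup.mem_center_iff.2 fun g => ?_)
  have hg : g ∈ Subgroup.closure (simpleSet cs) := by
    rw [closure_simpleSet]
    exact Subgroup.mem_top g
  have hle : Subgroup.closure (simpleSet cs) ≤ Subgroup.centralizer {w₀} := by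
    rw [Subgroup.closure_le]
    intro r hrs
    rw [SetLike.mem_coe, Subgroup.mem_centralizer_singleton_iff]
    exact (mul_inv_eq_iff_eq_mul.1 (hr r hrs)).symm
  exact Subgroup.mem_centralizer_singleton_iff.1 (hle hg)

variable [Fintype W]

/-- A longest element of W_I has descent set I. -/
theorem exists_invParity_eq_one_iff {I : Set W} (hI : I ⊆ simpleSet cs) :
    ∃ v : W, ∀ s ∈ simpleSet cs, invParity cs v s = 1 ↔ s ∈ I := by
  obtain ⟨v, hv, hmax⟩ := (Set.toFinite (Subgroup.closure I : Set W)).exists_maximalFor cs.length _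
    ⟨1, one_mem _⟩
  refine ⟨v, fun s hs => ⟨fun h => mem_of_simple_mem_closure cs hI hs
    (mem_closure_of_invParity_eq_one cs hI hv h), fun h => ?_⟩⟩
  rw [← invParity_ne_zero]
  intro h0
  have h1 := (length_lt_mul_simple_iff cs hs).2 h0
  exact absurd (hmax (mul_mem hv (Subgroup.subset_closure h)) h1.le) (not_le.2 h1)

theorem diagCoeff_cast_zmod_two_eq_zero (hw₀ : IsLongest cs w₀) (hc : w₀ ∈ Subgroup.center W) {J : Set W}
    (hJ : J ⊂ simpleSet cs) (K : Set W) : (diagCoeff cs J K : ZMod 2) = 0 := by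
  classical
  choose r hr hr' using exists_mul_mem_setX cs hJ.1
  have hcom : ∀ g, g * w₀ = w₀ * g := Subgroup.mem_center_iff.1 hc
  rw [diagCoeff, Finset.cast_card]
  -- In terms of representatives: the coset d⁻¹ W_J is sent to d⁻¹ w₀ W_J.
  refine Finset.sum_involution (fun d _ => (d⁻¹ * w₀ * r (d⁻¹ * w₀))⁻¹) (fun _ _ => by decide)
    ?_ ?_ ?_
  · intro d _ _ h
    rw [inv_eq_iff_eq_inv, mul_assoc, mul_eq_left, mul_eq_one_iff_eq_inv] at h
    exact hw₀.not_mem_closure cs hJ (h ▸ inv_mem (hr _))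
  · intro d hd
    simp only [Finset.mem_filter, Finset.mem_univ, true_and, inv_inv] at hd ⊢
    refine ⟨hr' _, fun k hk => ?_⟩
    have h1 := mul_mem (mul_mem (inv_mem (hr (d⁻¹ * w₀))) (hd.2 k hk)) (hr (d⁻¹ * w₀))
    have h2 : ∀ x, w₀⁻¹ * x * w₀ = x := fun x => by rw [mul_assoc, hcom, inv_mul_cancel_left]
    have h3 : (d⁻¹ * w₀ * r (d⁻¹ * w₀))⁻¹ * k * (d⁻¹ * w₀ * r (d⁻¹ * w₀)) =
        (r (d⁻¹ * w₀))⁻¹ * (w₀⁻¹ * (d * k * d⁻¹) * w₀) * r (d⁻¹ * w₀) := by group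
    rwa [h3, h2]
  · intro d hd
    simp only [Finset.mem_filter, Finset.mem_univ, true_and] at hd
    rw [inv_eq_iff_eq_inv, inv_inv]
    refine eq_of_mem_setX cs hJ.1 (hr' _) hd.1 ?_
    generalize hq : r (d⁻¹ * w₀) = q
    have hqm : q ∈ Subgroup.closure J := hq ▸ hr _
    have h1 : d⁻¹ * w₀ * q * w₀ = d⁻¹ * q := by
      rw [mul_assoc (d⁻¹ * w₀), hcom q, mul_assoc, ← mul_assoc w₀ w₀,
        hw₀.mul_self cs, one_mul]
    rw [h1]
    have := mul_mem (inv_mem (hr (d⁻¹ * q))) (inv_mem hqm)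
    simpa [mul_assoc] using this

/-- A counted d ≠ 1 normalizes W_J and has r as a descent, so r is a descent of all of d W_J. A
longest element of d W_J then has every simple descent, so it is w₀, and w₀ normalizes W_J. But w₀ r
w₀⁻¹ is simple and not r, hence in W_J, forcing r ∈ W_J. -/
theorem diagCoeff_compl_singleton (hw₀ : IsLongest cs w₀) {r : W} (hr : r ∈ simpleSet cs)
    (hne : w₀ * r * w₀⁻¹ ≠ r) :
    diagCoeff cs (simpleSet cs \ {r}) (simpleSet cs \ {r}) = 1 := by
  classical
  set J := simpleSet cs \ {r} with hJdef
  have hJ : J ⊆ simpleSet cs := Set.sdiff_subset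
  have hrJ : r ∉ Subgroup.closure J := fun h => (mem_of_simple_mem_closure cs hJ hr h).2 rfl
  rw [diagCoeff, Finset.card_eq_one]
  refine ⟨1, Finset.eq_singleton_iff_unique_mem.2 ⟨?_, fun d hd => ?_⟩⟩
  · simp only [Finset.mem_filter, Finset.mem_univ, true_and, inv_one, one_mul, mul_one]
    exact ⟨(mem_setX_iff cs hJ).2 (by simp), fun k hk => Subgroup.subset_closure hk⟩
  simp only [Finset.mem_filter, Finset.mem_univ, true_and] at hd
  obtain ⟨hdX, hdJ⟩ := hd
  by_contra hd1
  have hdr : invParity cs d r = 1 := by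
    rw [← invParity_ne_zero]
    intro h0
    refine hd1 (eq_one_of_forall_invParity_eq_zero cs fun s hs => ?_)
    by_cases hsr : s = r
    · rwa [hsr]
    · exact invParity_eq_zero_of_conj_mem cs hJ hdX (hdJ s ⟨hs, hsr⟩)
  have hdN : d ∈ Subgroup.normalizer (Subgroup.closure J : Set W) := by
    refine Subgroup.mem_normalizer_fintype fun n hn => ?_
    have hle : Subgroup.closure J ≤ (Subgroup.closure J).comap (MulAut.conj d).toMonoidHom := by
      rw [Subgroup.closure_le]
      exact fun j hj => hdJ j hj
    exact hle hn
  have hdu : ∀ u ∈ Subgroup.closure J, invParity cs (d * u) r = 1 := by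
    intro u hu
    have hv := (Subgroup.mem_normalizer_iff.1 hdN u).1 hu
    have e : d * u = d * u * d⁻¹ * d := by simp
    rw [e, invParity_mul, hdr]
    have h0 : invParity cs (d * u * d⁻¹) (d * r * d⁻¹) = 0 := by
      rw [← invParity_ne_one]
      exact fun h => hrJ ((Subgroup.mem_normalizer_iff.1 hdN r).2
        (mem_closure_of_invParity_eq_one cs hJ hv h))
    rw [h0, add_zero]
  obtain ⟨u, hu, hmax⟩ := (Set.toFinite (Subgroup.closure J : Set W)).exists_maximalFor
    (fun u => cs.length (d * u)) _ ⟨1, one_mem _⟩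
  have hx : d * u = w₀ := hw₀.eq_of_forall_invParity_eq_one cs fun s hs => by
    by_cases hsr : s = r
    · rw [hsr]
      exact hdu u hu
    · rw [← invParity_ne_zero]
      intro h0
      have h1 := (length_lt_mul_simple_iff cs hs).2 h0
      rw [mul_assoc] at h1
      exact absurd (hmax (mul_mem hu (Subgroup.subset_closure ⟨hs, hsr⟩)) h1.le) (not_le.2 h1)
  have hN : w₀ ∈ Subgroup.normalizer (Subgroup.closure J : Set W) :=
    hx ▸ mul_mem hdN (Subgroup.le_normalizer hu)
  exact hrJ ((Subgroup.mem_normalizer_iff.1 hN r).2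
    (Subgroup.subset_closure ⟨hw₀.conj_mem_simpleSet cs hr, hne⟩))

end Longest

/-! ### Inclusion-exclusion and invertibility for central w₀ -/

open Classical in
theorem sum_powerset_neg_one_pow_ite {α : Type*} (P : Finset α) (A : Set α) :
    ∑ T ∈ P.powerset, (-1 : ℚ) ^ T.card * (if (T : Set α) ⊆ A then 1 else 0) =
      if Disjoint (P : Set α) A then 1 else 0 := by
  have h1 : P.powerset.filter (fun T : Finset α => (T : Set α) ⊆ A) =
      (P.filter (· ∈ A)).powerset := by
    ext T
    simp only [Finset.mem_filter, Finset.mem_powerset, Finset.subset_iff, Set.subset_def,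
      Finset.mem_coe]
    exact ⟨fun h x hx => ⟨h.1 hx, h.2 x hx⟩, fun h => ⟨fun x hx => (h hx).1, fun x hx => (h hx).2⟩⟩
  have h2 : P.filter (· ∈ A) = ∅ ↔ Disjoint (P : Set α) A := by
    rw [Finset.filter_eq_empty_iff, Set.disjoint_left]
    rfl
  have h3 := congrArg (Int.cast : ℤ → ℚ)
    (Finset.sum_powerset_neg_one_pow_card (x := P.filter (· ∈ A)))
  push_cast at h3
  simp only [mul_ite, mul_one, mul_zero]
  rw [← Finset.sum_filter, h1, h3]
  simp only [h2]

variable {B W : Type*} [Group W] {M : CoxeterMatrix B} (cs : CoxeterSystem M W)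

theorem mem_setX_iff_subset_ascentSet {I : Set W} (hI : I ⊆ simpleSet cs) {w : W} :
    w ∈ setX cs I ↔ I ⊆ ascentSet cs w :=
  ⟨fun h s hs => ⟨hI hs, h s hs⟩, fun h _ hs => (h hs).2⟩

variable [Fintype W]

open Classical in
theorem elemX_coeff (I : Set W) (w : W) :
    (elemX cs I).coeff w = if w ∈ setX cs I then 1 else 0 := setSum_coeff _ _

open Classical in
theorem elemY_coeff (J : Set W) (w : W) :
    (elemY cs J).coeff w = if ascentSet cs w = J then 1 else 0 := setSum_coeff _ _

open Classical in
theorem elemY_eq_sum {J : Set W} (hJ : J ⊆ simpleSet cs) {P : Finset W}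
    (hP : (P : Set W) = simpleSet cs \ J) :
    elemY cs J = ∑ T ∈ P.powerset, (-1 : ℚ) ^ T.card • elemX cs (J ∪ T) := by
  ext w
  have h1 : ∀ T ∈ P.powerset, ((-1 : ℚ) ^ T.card • elemX cs (J ∪ T)).coeff w =
        (if J ⊆ ascentSet cs w then 1 else 0) *
          ((-1 : ℚ) ^ T.card * (if (T : Set W) ⊆ ascentSet cs w then 1 else 0)) := by
    intro T hT
    have hTS : (T : Set W) ⊆ simpleSet cs := by
      rw [Finset.mem_powerset, ← Finset.coe_subset, hP] at hT
      exact hT.trans Set.sdiff_subset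
    rw [MonoidAlgebra.coeff_smul_apply, elemX_coeff,
      mem_setX_iff_subset_ascentSet cs (Set.union_subset hJ hTS), Set.union_subset_iff]
    by_cases h1 : J ⊆ ascentSet cs w <;> by_cases h2 : (T : Set W) ⊆ ascentSet cs w <;>
      simp [h1, h2]
  rw [MonoidAlgebra.coeff_sum, Finsupp.finsetSum_apply, Finset.sum_congr rfl h1, ← Finset.mul_sum,
    sum_powerset_neg_one_pow_ite, elemY_coeff, hP, ite_zero_mul_ite_zero, one_mul]
  refine if_congr ?_ rfl rfl
  constructor
  · intro h
    rw [h]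
    exact ⟨subset_rfl, Set.disjoint_sdiff_left⟩
  · rintro ⟨h1, h2⟩
    refine (h1.antisymm fun s hs => ?_).symm
    by_contra hsJ
    exact Set.disjoint_left.1 h2 ⟨hs.1, hsJ⟩ hs

theorem elemX_mem_descentAlgebra {I : Set W} (hI : I ⊆ simpleSet cs) :
    elemX cs I ∈ descentAlgebra cs := Submodule.subset_span ⟨I, hI, rfl⟩

theorem elemY_mem_descentAlgebra {J : Set W} (hJ : J ⊆ simpleSet cs) :
    elemY cs J ∈ descentAlgebra cs := by
  classical
  rw [elemY_eq_sum cs hJ (Set.coe_toFinset _)]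
  refine Submodule.sum_mem _ fun T hT => Submodule.smul_mem _ _ (elemX_mem_descentAlgebra cs ?_)
  rw [Finset.mem_powerset, ← Finset.coe_subset, Set.coe_toFinset] at hT
  exact Set.union_subset hJ (hT.trans Set.sdiff_subset)

theorem exists_elemY_mul_elemX_sub_mem {w₀ : W} (hw₀ : IsLongest cs w₀)
    (hc : w₀ ∈ Subgroup.center W) {J K : Set W} (hJ : J ⊆ simpleSet cs) (hK : K ⊆ simpleSet cs) :
    ∃ c : ℚ, c ≠ 0 ∧ elemY cs J * elemX cs K - c • elemX cs K ∈ spanBelow cs K := by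
  classical
  set P := (simpleSet cs \ J).toFinset with hP
  have hsub : ∀ T ∈ P.powerset, J ∪ (T : Set W) ⊆ simpleSet cs := by
    intro T hT
    rw [Finset.mem_powerset, ← Finset.coe_subset, hP, Set.coe_toFinset] at hT
    exact Set.union_subset hJ (hT.trans Set.sdiff_subset)
  have hz : (((∑ T ∈ P.powerset, (-1 : ℤ) ^ T.card * (diagCoeff cs (J ∪ T) K : ℤ)) : ℤ) : ZMod 2)
      = 1 := by
    push_cast
    -- Modulo 2 only T = P survives, where J ∪ T = S.
    rw [Finset.sum_eq_single_of_mem P (Finset.mem_powerset_self P)]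
    · have : J ∪ (P : Set W) = simpleSet cs := by
        rw [hP, Set.coe_toFinset, Set.union_sdiff_cancel hJ]
      rw [this, diagCoeff_simpleSet, ZMod.neg_eq_self_mod_two]
      simp
    · intro T hT hne
      rw [diagCoeff_cast_zmod_two_eq_zero cs hw₀ hc ((hsub T hT).ssubset_of_ne fun h => hne ?_), mul_zero]
      refine (Finset.mem_powerset.1 hT).antisymm fun s hs => ?_
      rw [hP, Set.mem_toFinset, ← h] at hs
      exact hs.1.resolve_left hs.2
  refine ⟨((∑ T ∈ P.powerset, (-1 : ℤ) ^ T.card * (diagCoeff cs (J ∪ T) K : ℤ) : ℤ) : ℚ), ?_, ?_⟩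
  · rw [Int.cast_ne_zero]
    intro h
    rw [h, Int.cast_zero] at hz
    exact zero_ne_one hz
  · push_cast
    rw [elemY_eq_sum cs hJ (hP ▸ Set.coe_toFinset _), Finset.sum_mul, Finset.sum_smul,
      ← Finset.sum_sub_distrib]
    refine Submodule.sum_mem _ fun T hT => ?_
    rw [smul_mul_assoc, mul_smul, ← smul_sub]
    exact Submodule.smul_mem _ _ (elemX_mul_elemX_sub_mem cs (hsub T hT) hK)

/-- Back substitution in the triangular system; K = S then puts 1 in the image, giving a right
inverse in Σ(W). -/
theorem elemX_mem_map_mulLeft_elemY {w₀ : W} (hw₀ : IsLongest cs w₀)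
    (hc : w₀ ∈ Subgroup.center W) {J : Set W} (hJ : J ⊆ simpleSet cs) (K : Set W)
    (hK : K ⊆ simpleSet cs) :
    elemX cs K ∈ (descentAlgebra cs).map (LinearMap.mulLeft ℚ (elemY cs J)) := by
  induction K using WellFoundedLT.induction with
  | _ K ih =>
    obtain ⟨c, hc0, hmem⟩ := exists_elemY_mul_elemX_sub_mem cs hw₀ hc hJ hK
    have hle : spanBelow cs K ≤ (descentAlgebra cs).map (LinearMap.mulLeft ℚ (elemY cs J)) := by
      refine Submodule.span_le.2 ?_
      rintro _ ⟨L, hL, rfl⟩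
      exact ih L hL (hL.1.trans hK)
    have h1 : elemY cs J * elemX cs K ∈
        (descentAlgebra cs).map (LinearMap.mulLeft ℚ (elemY cs J)) :=
      ⟨_, elemX_mem_descentAlgebra cs hK, rfl⟩
    have h2 := Submodule.sub_mem _ h1 (hle hmem)
    rw [sub_sub_cancel] at h2
    exact (Submodule.smul_mem_iff _ hc0).1 h2

theorem isInvertible_elemY {w₀ : W} (hw₀ : IsLongest cs w₀)
    (hc : w₀ ∈ Subgroup.center W) {J : Set W} (hJ : J ⊆ simpleSet cs) :
    IsInvertible cs (elemY cs J) := by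
  obtain ⟨b, hb, hyb⟩ := elemX_mem_map_mulLeft_elemY cs hw₀ hc hJ (simpleSet cs) subset_rfl
  rw [elemX_simpleSet, LinearMap.mulLeft_apply] at hyb
  refine ⟨elemY_mem_descentAlgebra cs hJ, b, hb, hyb, ?_⟩
  -- In the finite-dimensional ℚW a right inverse is two-sided: surjectivity of left multiplication
  -- gives injectivity.
  have hsurj : Function.Surjective (LinearMap.mulLeft ℚ (elemY cs J)) := fun z =>
    ⟨b * z, by rw [LinearMap.mulLeft_apply, ← mul_assoc, hyb, one_mul]⟩
  refine LinearMap.injective_iff_surjective.2 hsurj ?_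
  rw [LinearMap.mulLeft_apply, LinearMap.mulLeft_apply, ← mul_assoc, hyb, one_mul, mul_one]

/-! ### Failure of invertibility for noncentral w₀ -/

theorem spanBelow_mono {L K : Set W} (h : L ⊆ K) : spanBelow cs L ≤ spanBelow cs K :=
  Submodule.span_mono fun _ ⟨I, hI, hx⟩ => ⟨I, hI.trans_subset h, hx⟩

theorem elemX_notMem_spanBelow {J : Set W} (hJ : J ⊆ simpleSet cs) :
    elemX cs J ∉ spanBelow cs J := by
  classical
  choose! v hv using fun (I : Set W) (hI : I ⊆ simpleSet cs) =>
    exists_invParity_eq_one_iff cs hI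
  -- With v I of descent set I, this alternating sum takes x_L, L ⊆ J, to 1 if L = J and to 0
  -- otherwise, so it separates x_J from the span.
  let f : MonoidAlgebra ℚ W → ℚ := fun z =>
    ∑ I ∈ J.toFinset.powerset, (-1 : ℚ) ^ I.card * z.coeff (v I)
  have hf : ∀ L ⊆ J, f (elemX cs L) = if J ⊆ L then 1 else 0 := by
    intro L hL
    have h1 : ∀ I ∈ J.toFinset.powerset, (-1 : ℚ) ^ I.card * (elemX cs L).coeff (v I) =
        (-1 : ℚ) ^ I.card * (if (I : Set W) ⊆ Lᶜ then 1 else 0) := by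
      intro I hI
      rw [Finset.mem_powerset, ← Finset.coe_subset, Set.coe_toFinset] at hI
      rw [elemX_coeff]
      refine congrArg _ (if_congr ((mem_setX_iff cs (hL.trans hJ)).trans
        ⟨fun h s hs hsL => ?_, fun h s hs => ?_⟩) rfl rfl)
      · have := (hv I (hI.trans hJ) s (hJ (hI hs))).2 hs
        rw [h s hsL] at this
        exact zero_ne_one this
      · rw [← invParity_ne_one]
        exact fun h1 => h ((hv I (hI.trans hJ) s (hJ (hL hs))).1 h1) hs
    simp only [f]
    rw [Finset.sum_congr rfl h1, sum_powerset_neg_one_pow_ite, Set.coe_toFinset,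
      Set.disjoint_compl_right_iff_subset]
  have hzero : ∀ z ∈ spanBelow cs J, f z = 0 := by
    intro z hz
    induction hz using Submodule.span_induction with
    | mem x hx =>
      obtain ⟨L, hL, rfl⟩ := hx
      rw [hf L hL.1, if_neg hL.2]
    | zero => simp [f]
    | add x y _ _ hx hy =>
      simp only [f, MonoidAlgebra.coeff_add, Finsupp.add_apply, mul_add, Finset.sum_add_distrib]
        at hx hy ⊢
      rw [hx, hy, add_zero]
    | smul a x _ hx =>
      simp only [f, MonoidAlgebra.coeff_smul_apply, smul_eq_mul, mul_left_comm _ a,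
        ← Finset.mul_sum] at hx ⊢
      rw [hx, mul_zero]
  intro h
  have h1 := hzero _ h
  rw [hf J subset_rfl, if_pos subset_rfl] at h1
  exact one_ne_zero h1

theorem elemY_compl_singleton {r : W} (hr : r ∈ simpleSet cs) :
    elemY cs (simpleSet cs \ {r}) = elemX cs (simpleSet cs \ {r}) - 1 := by
  classical
  have : simpleSet cs \ (simpleSet cs \ {r}) = {r} := by
    rw [Set.sdiff_sdiff_right_self, Set.inter_eq_right.2 (Set.singleton_subset_iff.2 hr)]
  have hP : ((insert r ∅ : Finset W) : Set W) = simpleSet cs \ (simpleSet cs \ {r}) := by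
    simp [this]
  rw [elemY_eq_sum cs Set.sdiff_subset hP, Finset.sum_powerset_insert (Finset.notMem_empty r),
    ← elemX_simpleSet cs]
  simp [Set.insert_eq_of_mem hr, sub_eq_add_neg]

theorem not_isInvertible_elemY {w₀ : W} (hw₀ : IsLongest cs w₀) {r : W}
    (hr : r ∈ simpleSet cs) (hne : w₀ * r * w₀⁻¹ ≠ r) :
    ¬ IsInvertible cs (elemY cs (simpleSet cs \ {r})) := by
  rintro ⟨-, b, -, -, hby⟩
  rw [elemY_compl_singleton cs hr] at hby
  have hdiag := diagCoeff_compl_singleton cs hw₀ hr hne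
  set J := simpleSet cs \ {r} with hJdef
  have hJ : J ⊆ simpleSet cs := Set.sdiff_subset
  set φ := LinearMap.mulLeft ℚ (elemX cs J - 1) with hφ
  have hinj : Function.Injective φ := fun x y hxy => by
    have := congrArg (b * ·) hxy
    simpa [hφ, ← mul_assoc, hby] using this
  set F : Submodule ℚ (MonoidAlgebra ℚ W) :=
    Submodule.span ℚ {x | ∃ L : Set W, L ⊆ J ∧ x = elemX cs L} with hF
  have hle : spanBelow cs J ≤ F := Submodule.span_mono fun _ ⟨L, hL, hx⟩ => ⟨L, hL.1, hx⟩
  have hmap : F.map φ ≤ spanBelow cs J := by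
    rw [hF, Submodule.map_span, Submodule.span_le]
    rintro _ ⟨_, ⟨L, hL, rfl⟩, rfl⟩
    have h1 := elemX_mul_elemX_sub_mem cs hJ (hL.trans hJ)
    rw [SetLike.mem_coe, hφ, LinearMap.mulLeft_apply, sub_mul, one_mul]
    rcases hL.eq_or_ssubset with rfl | hlt
    · rwa [hdiag, Nat.cast_one, one_smul] at h1
    · have h2 : elemX cs L ∈ spanBelow cs J := Submodule.subset_span ⟨L, hlt, rfl⟩
      refine Submodule.sub_mem _ ?_ h2
      have := Submodule.add_mem _ (spanBelow_mono cs hL h1)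
        (Submodule.smul_mem _ (diagCoeff cs J L : ℚ) h2)
      rwa [sub_add_cancel] at this
  -- An injective φ preserves dimension, so it would map F onto itself, although its image misses
  -- x_J.
  have heq : F.map φ = F := Submodule.eq_of_le_of_finrank_le (hmap.trans hle)
    (F.equivMapOfInjective φ hinj).finrank_eq.le
  refine elemX_notMem_spanBelow cs hJ (hmap ?_)
  rw [heq]
  exact Submodule.subset_span ⟨J, subset_rfl, rfl⟩

end DescentAlgebra

theorem mainTheorem9 {B W : Type*} [Group W] [Fintype W] {M : CoxeterMatrix B}
    (cs : CoxeterSystem M W) (w₀ : W) (hw₀ : DescentAlgebra.IsLongest cs w₀) :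
    w₀ ∈ Subgroup.center W ↔
      ∀ J : Set W, J ⊆ DescentAlgebra.simpleSet cs →
        DescentAlgebra.IsInvertible cs (DescentAlgebra.elemY cs J) := by
  refine ⟨fun hc J hJ => DescentAlgebra.isInvertible_elemY cs hw₀ hc hJ, fun h => ?_⟩
  by_contra hc
  obtain ⟨r, hr, hne⟩ := DescentAlgebra.exists_simple_conj_ne cs hc
  exact DescentAlgebra.not_isInvertible_elemY cs hw₀ hr hne (h _ Set.sdiff_subset)
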